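/- **Definitions.** An HC-tree on $V=\{v_1,\dots,v_n\}$ is a finite rooted tree $T$ whose leaf set is $V$. For a similarity graph $G$ with symmetric weights $w_{ij}\ge 0$ ($w_{ij}=0$ for non-edges) and three distinct indices $i,j,k$, the triplet cost $\mathrm{tc}_{T,G}(i,j,k)$ is $w_{ik}+w_{jk}$ if the lowest common ancestor of $v_i,v_j$ in $T$ is a proper descendant of that of $v_i,v_j,v_k$, and similarly with the roles of $i,j,k$ permuted; if none of these three cases occurs it is $w_{ij}+w_{ik}+w_{jk}$. Put $$\mathrm{TC}_G(T)=\sum_{\{i,j,k\}}\mathrm{tc}_{T,G}(i,j,k),\qquad \mathrm{BC}(G)=\sum_{\{i,j,k\}}\min\{w_{ij}+w_{ik},\,w_{ij}+w_{jk},\,w_{ik}+w_{jk}\},\qquad \rho_G(T)=\frac{\mathrm{TC}_G(T)}{\mathrm{BC}(G)},$$ where the sums run over unordered triplets of distinct indices, $0/0=1$, and $x/0=+\infty$ for $x>0$. An HC-tree is optimal for $G$ if it minimizes $\rho_G$; the minimum is $\rho^*_G$. For a symmetric $n\times n$ matrix $P$ with entries in $[0,1]$, a random graph $G$ generated from $P$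 has vertices $v_1,\dots,v_n$ and contains each edge $v_iv_j$ ($i\ne j$), with unit weight, independently with probability $P_{ij}$. The expectation graph $\bar G$ is the weighted graph with $w_{ij}=P_{ij}$, and $\bar T^*$ denotes an optimal HC-tree for $\bar G$. **Theorem.** 1. There is a constant $\varepsilon>0$ such that the following holds. Let $P^{(n)}$ ($n\ge 1$) be symmetric $n\times n$ matrices with entries in $[0,1]$ and $\min_{i\ne j}P^{(n)}_{ij}=\omega\bigl(\sqrt{\log n/n}\bigr)$ as $n\to\infty$. Then there are numbers $\delta_n\to 0$ such that for all sufficiently large $n$, if $G$ is a random graph generated from $P^{(n)}$ and $\bar T^*$ is any optimal HC-tree for the expectation graph $\bar G$, then with probability larger than $1-n^{-\varepsilon}$ $$(1-\delta_n)\,\frac{\mathrm{TC}_{\bar G}(\bar T^*)}{\mathbb E[\mathrm{BC}(G)]}\;\le\;\rho^*_G\;\le\;(1+\delta_n)\,\frac{\mathrm{TC}_{\bar G}(\bar T^*)}{\mathbb E[\mathrm{BC}(G)]}.$$ That is, w.h.p. $\rho^*_G=(1+o(1))\,\mathrm{TC}_{\bar G}(\bar T^*)/\mathbb E[\mathrm{BC}(G)]$.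 2. This value generally differs from $\rho^*_{\bar G}$: if $n\ge 3$ and $0<P_{ij}<1$ for all $i\ne j$, then $\mathrm{TC}_{\bar G}(\bar T^*)/\mathbb E[\mathrm{BC}(G)]\ne\rho^*_{\bar G}$. 3. The difference does not vanish asymptotically in general: if $P_{ij}=p$ for all $i,j$, with a constant $p\in(0,1)$, then for every $n\ge 3$ one has $\rho^*_{\bar G}=1$ while $\mathrm{TC}_{\bar G}(\bar T^*)/\mathbb E[\mathrm{BC}(G)]=\dfrac{2}{3p-p^2}>1$. -/

import Mathlib

open MeasureTheory ProbabilityTheory Filter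

/-- A hierarchical clustering tree (HC-tree) on `n` points: a finite rooted tree together with a
labelling of its leaves by the points. In a `RootedTree` the order is ancestorship (`⊥` is the root,
`a ≤ b` means that `a` is an ancestor of `b`), `a ⊓ b` is the lowest common ancestor, and the leaves
are the maximal elements. Internal nodes may have any number of children. -/
structure HCTree (n : ℕ) where
  tree : RootedTree.{0}
  finite_tree : Finite tree
  leaf : Fin n → tree
  leaf_injective : Function.Injective leaf
  range_leaf : Set.range leaf = {x : tree | IsMax x}

namespace HCTree

/-- The relation `{i, j | k}`: the lowest common ancestor of `i, j` is a proper descendant of the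
lowest common ancestor of `i, j, k`. -/
def Merges {n : ℕ} (T : HCTree n) (i j k : Fin n) : Prop :=
  T.leaf i ⊓ T.leaf j ⊓ T.leaf k < T.leaf i ⊓ T.leaf j

end HCTree

noncomputable section

open Classical in
/-- The cost of the triplet `{i, j, k}` induced by `T`. If none of the three relations
`{i, j | k}`, `{i, k | j}`, `{j, k | i}` holds, the three leaves are merged at the same node. -/
def tripletCost {n : ℕ} (w : Matrix (Fin n) (Fin n) ℝ) (T : HCTree n) (i j k : Fin n) : ℝ :=
  if T.Merges i j k then w i k + w j k
  else if T.Merges i k j then w i j + w j k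
  else if T.Merges j k i then w i j + w i k
  else w i j + w j k + w i k

/-- The set of triplets of points, each listed once, in increasing order. -/
def triplets (n : ℕ) : Finset (Fin n × Fin n × Fin n) :=
  Finset.univ.filter fun t => t.1 < t.2.1 ∧ t.2.1 < t.2.2

/-- The total cost of `T` with respect to the similarity graph with weight matrix `w`. -/
def totalCost {n : ℕ} (w : Matrix (Fin n) (Fin n) ℝ) (T : HCTree n) : ℝ :=
  ∑ t ∈ triplets n, tripletCost w T t.1 t.2.1 t.2.2

/-- The min-triplet cost. -/
def minTripletCost {n : ℕ} (w : Matrix (Fin n) (Fin n) ℝ) (i j k : Fin n) : ℝ :=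
  min (w i j + w i k) (min (w i j + w j k) (w i k + w j k))

/-- The base cost of the similarity graph with weight matrix `w`. -/
def baseCost {n : ℕ} (w : Matrix (Fin n) (Fin n) ℝ) : ℝ :=
  ∑ t ∈ triplets n, minTripletCost w t.1 t.2.1 t.2.2

open Classical in
/-- The ratio cost `totalCost / baseCost`, with the conventions `0 / 0 = 1` and `x / 0 = ∞` for
`x > 0`. -/
def ratioCost {n : ℕ} (w : Matrix (Fin n) (Fin n) ℝ) (T : HCTree n) : EReal :=
  if baseCost w = 0 then (if totalCost w T = 0 then 1 else ⊤)
  else ((totalCost w T / baseCost w : ℝ) : EReal)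

/-- `T` is an optimal HC-tree: it minimizes the ratio cost. -/
def IsOptimalTree {n : ℕ} (w : Matrix (Fin n) (Fin n) ℝ) (T : HCTree n) : Prop :=
  ∀ T' : HCTree n, ratioCost w T ≤ ratioCost w T'

/-- The optimal ratio cost `ρ*`, i.e. the minimum of the ratio cost over all HC-trees. The infimum
is attained, see `exists_isOptimalTree`. -/
def optRatioCost {n : ℕ} (w : Matrix (Fin n) (Fin n) ℝ) : EReal :=
  ⨅ T : HCTree n, ratioCost w T

/-- The nodes of the star: a root and `n` leaves, which are its children. -/
inductive StarNode (n : ℕ) : Type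
  | root : StarNode n
  | leaf : Fin n → StarNode n

open Classical in
instance (n : ℕ) : SemilatticeInf (StarNode n) where
  le a b := a = .root ∨ a = b
  le_refl a := Or.inr rfl
  le_trans := by
    rintro a b c (h | h) (h' | h')
    · exact Or.inl h
    · exact Or.inl h
    · exact Or.inl (h.trans h')
    · exact Or.inr (h.trans h')
  le_antisymm := by
    rintro a b (h | h) (h' | h')
    · exact h.trans h'.symm
    · exact h'.symm
    · exact h
    · exact h
  inf a b := if a = b then a else .root
  inf_le_left a b := by
    split_ifs
    · exact Or.inr rfl
    · exact Or.inl rfl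
  inf_le_right a b := by
    split_ifs with h
    · exact Or.inr h
    · exact Or.inl rfl
  le_inf a b c hab hac := by
    rcases hab with h | h
    · exact Or.inl h
    rcases hac with h' | h'
    · exact Or.inl h'
    · rw [if_pos (h.symm.trans h')]
      exact Or.inr h

instance (n : ℕ) : OrderBot (StarNode n) where
  bot := .root
  bot_le _ := Or.inl rfl

instance (n : ℕ) : PredOrder (StarNode n) where
  pred _ := .root
  pred_le _ := Or.inl rfl
  min_of_le_pred := by
    rintro a (h | h) b hb
    · exact Or.inl h
    · exact Or.inl h
  le_pred_of_lt := by
    rintro a b ⟨h | h, h'⟩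
    · exact Or.inl h
    · exact absurd (Or.inr h.symm) h'

instance (n : ℕ) : IsPredArchimedean (StarNode n) where
  exists_pred_iterate_of_le := by
    rintro a b (h | h)
    · exact ⟨1, h.symm⟩
    · exact ⟨0, h.symm⟩

lemma nonempty_hcTree {n : ℕ} (hn : 0 < n) : Nonempty (HCTree n) := by
  have hfin : Finite (StarNode n) :=
    Finite.of_surjective (fun o : Option (Fin n) => o.elim StarNode.root StarNode.leaf) (by
      rintro (_ | i)
      · exact ⟨none, rfl⟩
      · exact ⟨some i, rfl⟩)
  refine ⟨⟨⟨StarNode n⟩, hfin, StarNode.leaf, fun i j h => StarNode.leaf.inj h, ?_⟩⟩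
  ext x
  constructor
  · rintro ⟨i, rfl⟩ y (h | h)
    · cases h
    · exact Or.inr h.symm
  · intro hx
    cases x with
    | root =>
      have h : StarNode.leaf ⟨0, hn⟩ ≤ StarNode.root := hx (Or.inl rfl)
      rcases h with h | h <;> cases h
    | leaf i => exact ⟨i, rfl⟩

/-- An optimal HC-tree exists as soon as there is at least one point. -/
lemma exists_isOptimalTree {n : ℕ} (hn : 0 < n) (w : Matrix (Fin n) (Fin n) ℝ) :
    ∃ T : HCTree n, IsOptimalTree w T := by
  classical
  have := nonempty_hcTree hn
  have key : ∀ T T' : HCTree n, T.Merges = T'.Merges → ratioCost w T = ratioCost w T' := by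
    intro T T' h
    have ht : ∀ i j k, tripletCost w T i j k = tripletCost w T' i j k := by
      intro i j k
      unfold tripletCost
      rw [h]
    unfold ratioCost totalCost
    simp only [ht]
  have hfin : (Set.range (ratioCost w)).Finite := by
    refine (Set.finite_range fun r : Set.range (HCTree.Merges (n := n)) =>
      ratioCost w r.2.choose).subset ?_
    rintro _ ⟨T, rfl⟩
    exact ⟨⟨T.Merges, T, rfl⟩, key _ _ (Set.mem_range_self (f := HCTree.Merges) T).choose_spec⟩
  obtain ⟨_, ⟨T, rfl⟩, hT⟩ := Set.exists_min_image _ id hfin (Set.range_nonempty _)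
  exact ⟨T, fun T' => hT _ ⟨T', rfl⟩⟩

open Classical in
/-- The weight matrix of an unweighted graph: every edge has unit weight. -/
def unitWeight {n : ℕ} (G : SimpleGraph (Fin n)) : Matrix (Fin n) (Fin n) ℝ :=
  Matrix.of fun i j => if G.Adj i j then 1 else 0

/-- An edge probability matrix. It is also the weight matrix of its expectation graph. -/
structure IsEdgeProbMatrix {n : ℕ} (P : Matrix (Fin n) (Fin n) ℝ) : Prop where
  isSymm : P.IsSymm
  mem_Icc : ∀ i j, P i j ∈ Set.Icc (0 : ℝ) 1

/-- `G` is a random graph generated from the matrix `P`: the edges `{i, j}`, `i ≠ j`, are present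
independently, with probabilities `P i j`. -/
structure IsRandomGraph {n : ℕ} {Ω : Type*} [MeasurableSpace Ω] (P : Matrix (Fin n) (Fin n) ℝ)
    (μ : Measure Ω) (G : Ω → SimpleGraph (Fin n)) : Prop where
  measurable : Measurable G
  prob_adj : ∀ i j, i ≠ j → μ.real {ω | (G ω).Adj i j} = P i j
  indep : iIndepSet (fun e : {e : Fin n × Fin n // e.1 < e.2} =>
    {ω | (G ω).Adj e.1.1 e.1.2}) μ

/-- The expected base cost of a random graph. -/
def expBaseCost {n : ℕ} {Ω : Type*} [MeasurableSpace Ω] (μ : Measure Ω)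
    (G : Ω → SimpleGraph (Fin n)) : ℝ :=
  ∫ ω, baseCost (unitWeight (G ω)) ∂μ

end

/-! A pair contributes its weight once for every further leaf below its lowest common ancestor.
Counting those leaves by size thresholds writes the total cost of any tree as a sum of fewer than
`n` cut weights of partitions (`totalCost_eq_sum_cutWeight`). Partitions are coded by functions `Fin
n → Fin n`, so Hoeffding and a union bound over `n ^ n` functions control all trees at once
(`measureReal_exists_cutWeight_le`). Cut weights then deviate by less than `n² √(log n / n)` and
total costs by at most `n` times that, which is negligible against a total cost of order at least
`n³ min P`.

For the base cost, triplets without a common pair are independent, so the variance is at most `18 n`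
times the mean (`variance_baseCost_le`). The mean is at least of order `n³ (min P)²`, far above `n²
log n`, and Chebyshev suffices. `optRatioCost_mem_Icc` combines the two estimates.

The value differs from the optimum of the expectation graph because the numerators agree while the
expected minimum is strictly below the minimum of the expectations (`expBaseCost_lt_baseCost`). For
constant weights the caterpillar attains the base cost. -/

/-! ### Lowest common ancestors and clusters of bounded size. -/

/-- Two ancestors of the same node of a rooted tree are comparable. -/
lemma RootedTree.le_total_of_le {t : RootedTree} {a b c : t} (ha : a ≤ c) (hb : b ≤ c) :
    a ≤ b ∨ b ≤ a := by
  obtain ⟨m, rfl⟩ := ha.exists_pred_iterate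
  obtain ⟨k, rfl⟩ := hb.exists_pred_iterate
  rcases le_total m k with h | h
  · exact Or.inr (Order.pred_mono.antitone_iterate_of_map_le (Order.pred_le c) h)
  · exact Or.inl (Order.pred_mono.antitone_iterate_of_map_le (Order.pred_le c) h)

namespace HCTree

variable {n : ℕ} (T : HCTree n)

lemma merges_iff (i j k : Fin n) : T.Merges i j k ↔ ¬ T.leaf i ⊓ T.leaf j ≤ T.leaf k := by
  unfold Merges
  rw [inf_lt_left]

lemma inf_le_leaf_or (i j k : Fin n) :
    T.leaf i ⊓ T.leaf j ≤ T.leaf i ⊓ T.leaf k ∨ T.leaf i ⊓ T.leaf k ≤ T.leaf i ⊓ T.leaf j :=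
  RootedTree.le_total_of_le inf_le_left inf_le_left

/-- At most one of the relations `{i, j | k}` and `{i, k | j}` holds. -/
lemma inf_le_or_inf_le (i j k : Fin n) :
    T.leaf i ⊓ T.leaf j ≤ T.leaf k ∨ T.leaf i ⊓ T.leaf k ≤ T.leaf j :=
  (T.inf_le_leaf_or i j k).imp (fun h => h.trans inf_le_right) fun h => h.trans inf_le_right

open Classical in
/-- The number of leaves below the lowest common ancestor of `i` and `j`. -/
noncomputable def lcaSize (i j : Fin n) : ℕ :=
  (Finset.univ.filter fun k => T.leaf i ⊓ T.leaf j ≤ T.leaf k).card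

lemma lcaSize_comm (i j : Fin n) : T.lcaSize i j = T.lcaSize j i := by
  unfold lcaSize
  rw [inf_comm]

lemma lcaSize_le (i j : Fin n) : T.lcaSize i j ≤ n := by
  classical
  exact (Finset.card_le_univ _).trans_eq (Fintype.card_fin n)

lemma lcaSize_mono {i j k l : Fin n} (h : T.leaf i ⊓ T.leaf j ≤ T.leaf k ⊓ T.leaf l) :
    T.lcaSize k l ≤ T.lcaSize i j := by
  classical
  refine Finset.card_le_card fun m => ?_
  simpa using h.trans

/-- Ultrametric inequality: the ancestors `i ⊓ j` and `j ⊓ k` of `j` are comparable, and the higher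
one lies above both `i` and `k`. This makes `clusterSetoid` transitive. -/
lemma lcaSize_le_max (i j k : Fin n) :
    T.lcaSize i k ≤ max (T.lcaSize i j) (T.lcaSize j k) := by
  rw [T.lcaSize_comm i j]
  rcases T.inf_le_leaf_or j i k with h | h
  · exact le_max_of_le_left (T.lcaSize_mono (le_inf inf_le_right (h.trans inf_le_right)))
  · exact le_max_of_le_right (T.lcaSize_mono (le_inf (h.trans inf_le_right) inf_le_right))

/-- The partition of the points into the maximal clusters of size at most `s`. -/
def clusterSetoid (s : ℕ) : Setoid (Fin n) where
  r i j := i = j ∨ T.lcaSize i j ≤ s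
  iseqv :=
    { refl := fun _ => Or.inl rfl
      symm := by
        rintro i j (h | h)
        · exact Or.inl h.symm
        · exact Or.inr (T.lcaSize_comm i j ▸ h)
      trans := by
        rintro i j k (rfl | hij) (rfl | hjk)
        · exact Or.inl rfl
        · exact Or.inr hjk
        · exact Or.inr hij
        · exact Or.inr ((T.lcaSize_le_max i j k).trans (max_le hij hjk)) }

/-- A representative of the cluster of `i` in the partition `clusterSetoid s`. -/
noncomputable def clusterRep (s : ℕ) (i : Fin n) : Fin n :=
  (Quotient.mk (T.clusterSetoid s) i).out

lemma clusterRep_eq_iff (s : ℕ) {i j : Fin n} (hij : i ≠ j) :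
    T.clusterRep s i = T.clusterRep s j ↔ T.lcaSize i j ≤ s := by
  unfold clusterRep
  rw [Quotient.out_inj, Quotient.eq]
  exact ⟨fun h => h.resolve_left hij, Or.inr⟩

open Classical in
lemma card_third_eq {i j : Fin n} (hij : i ≠ j) :
    (Finset.univ.filter fun k => (k ≠ i ∧ k ≠ j) ∧ T.leaf i ⊓ T.leaf j ≤ T.leaf k).card
      = T.lcaSize i j - 2 := by
  have h : (Finset.univ.filter fun k => (k ≠ i ∧ k ≠ j) ∧ T.leaf i ⊓ T.leaf j ≤ T.leaf k)
      = (Finset.univ.filter fun k => T.leaf i ⊓ T.leaf j ≤ T.leaf k) \ {i, j} := by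
    ext k
    simp
    tauto
  rw [h, Finset.card_sdiff_of_subset, Finset.card_pair hij]
  · rfl
  · intro k hk
    simp only [Finset.mem_insert, Finset.mem_singleton] at hk
    rcases hk with rfl | rfl <;> simp

open Classical in
/-- Layer-cake formula for the number of further leaves below a lowest common ancestor. -/
lemma lcaSize_sub_two_eq {i j : Fin n} (hij : i ≠ j) :
    ((T.lcaSize i j - 2 : ℕ) : ℝ)
      = ∑ s ∈ Finset.Ico 2 n, if T.clusterRep s i ≠ T.clusterRep s j then 1 else 0 := by
  -- The separating thresholds are those with `s < lcaSize i j`; since `lcaSize i j ≤ n`, the range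
  -- `[2, n)` misses none of them.
  rw [Finset.sum_boole, ← Nat.card_Ico]
  congr 2
  ext s
  have := T.lcaSize_le i j
  simp only [Finset.mem_Ico, Finset.mem_filter, ne_eq, T.clusterRep_eq_iff s hij]
  omega

-- A pair pays exactly when the third leaf lies below its lowest common ancestor. Comparability of
-- ancestors excludes two simultaneous merges, so the nested cases split into independent terms.
open Classical in
lemma tripletCost_eq (w : Matrix (Fin n) (Fin n) ℝ) (i j k : Fin n) :
    tripletCost w T i j k =
      (if T.leaf i ⊓ T.leaf j ≤ T.leaf k then w i j else 0)
      + (if T.leaf i ⊓ T.leaf k ≤ T.leaf j then w i k else 0)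
      + (if T.leaf j ⊓ T.leaf k ≤ T.leaf i then w j k else 0) := by
  unfold tripletCost
  simp only [merges_iff]
  have h1 := T.inf_le_or_inf_le i j k
  have h2 := T.inf_le_or_inf_le j i k
  have h3 := T.inf_le_or_inf_le k i j
  rw [inf_comm (T.leaf j) (T.leaf i)] at h2
  rw [inf_comm (T.leaf k) (T.leaf i), inf_comm (T.leaf k) (T.leaf j)] at h3
  split_ifs <;> first | ring1 | tauto

end HCTree

/-! ### The total cost as a sum of cut weights. -/

/-- Summing over the three ways to single out a pair of a triplet amounts to summing over all pairs
and all further points. -/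
lemma sum_triplets_pairs {n : ℕ} (A : Fin n → Fin n → Fin n → ℝ) :
    ∑ t ∈ triplets n, (A t.1 t.2.1 t.2.2 + A t.1 t.2.2 t.2.1 + A t.2.1 t.2.2 t.1)
      = ∑ i, ∑ j, if i < j then ∑ k, if k ≠ i ∧ k ≠ j then A i j k else 0 else 0 := by
  unfold triplets
  rw [Finset.sum_filter, Fintype.sum_prod_type]
  simp only [Fintype.sum_prod_type]
  -- The three indicators are the possible positions of `k` relative to `i < j`; renaming indices
  -- turns each into one term of the sorted sum.
  have e1 : ∀ i j : Fin n, (if i < j then ∑ k, (if k ≠ i ∧ k ≠ j then A i j k else 0) else 0)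
      = ∑ k, ((if i < j ∧ j < k then A i j k else 0) + (if i < k ∧ k < j then A i j k else 0)
          + (if k < i ∧ i < j then A i j k else 0)) := by
    intro i j
    split_ifs with h
    · refine Finset.sum_congr rfl fun k _ => ?_
      split_ifs <;> first | ring1 | (exfalso; omega)
    · symm
      refine Finset.sum_eq_zero fun k _ => ?_
      split_ifs <;> first | ring1 | (exfalso; omega)
  have e2 : ∀ i j k : Fin n, (if i < j ∧ j < k then A i j k + A i k j + A j k i else 0)
      = (if i < j ∧ j < k then A i j k else 0) + (if i < j ∧ j < k then A i k j else 0)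
          + (if i < j ∧ j < k then A j k i else 0) := by
    intro i j k
    split_ifs <;> simp
  simp only [e1, e2, Finset.sum_add_distrib]
  congr 1
  · congr 1
    refine Finset.sum_congr rfl fun i _ => ?_
    rw [Finset.sum_comm]
  · rw [Finset.sum_comm]
    refine Finset.sum_congr rfl fun i _ => ?_
    rw [Finset.sum_comm]

/-- The total cost is a weighted sum over pairs, in which `{i, j}` counts with the number of
further leaves below the lowest common ancestor of `i` and `j`. -/
lemma totalCost_eq_sum_pairs {n : ℕ} (w : Matrix (Fin n) (Fin n) ℝ) (T : HCTree n) :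
    totalCost w T =
      ∑ i, ∑ j, if i < j then ((T.lcaSize i j - 2 : ℕ) : ℝ) * w i j else 0 := by
  classical
  unfold totalCost
  simp only [T.tripletCost_eq]
  rw [sum_triplets_pairs fun i j k => if T.leaf i ⊓ T.leaf j ≤ T.leaf k then w i j else 0]
  refine Finset.sum_congr rfl fun i _ => Finset.sum_congr rfl fun j _ => ?_
  split_ifs with h
  · rw [← T.card_third_eq h.ne, Finset.card_filter]
    push_cast
    rw [Finset.sum_mul]
    refine Finset.sum_congr rfl fun k _ => ?_
    split_ifs <;> first | ring1 | (exfalso; tauto)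
  · rfl

/-- The total weight of the pairs that are separated by the partition into the fibres of `f`. -/
def cutWeight {n : ℕ} (w : Matrix (Fin n) (Fin n) ℝ) (f : Fin n → Fin n) : ℝ :=
  ∑ i, ∑ j, if i < j then (if f i ≠ f j then w i j else 0) else 0

/-- Insert the layer-cake formula and exchange sums. The tree now enters only through its threshold
partitions. -/
lemma totalCost_eq_sum_cutWeight {n : ℕ} (w : Matrix (Fin n) (Fin n) ℝ) (T : HCTree n) :
    totalCost w T = ∑ s ∈ Finset.Ico 2 n, cutWeight w (T.clusterRep s) := by
  classical
  rw [totalCost_eq_sum_pairs]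
  unfold cutWeight
  symm
  rw [Finset.sum_comm]
  refine Finset.sum_congr rfl fun i _ => ?_
  rw [Finset.sum_comm]
  refine Finset.sum_congr rfl fun j _ => ?_
  symm
  split_ifs with h
  · rw [T.lcaSize_sub_two_eq h.ne, Finset.sum_mul]
    refine Finset.sum_congr rfl fun s _ => ?_
    split_ifs <;> simp
  · simp

/-- Uniform closeness on partitions implies uniform closeness of the total costs of all trees. -/
lemma abs_totalCost_sub_le {n : ℕ} {w v : Matrix (Fin n) (Fin n) ℝ} {t : ℝ} (ht : 0 ≤ t)
    (h : ∀ f, |cutWeight w f - cutWeight v f| ≤ t) (T : HCTree n) :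
    |totalCost w T - totalCost v T| ≤ n * t := by
  rw [totalCost_eq_sum_cutWeight, totalCost_eq_sum_cutWeight, ← Finset.sum_sub_distrib]
  refine (Finset.abs_sum_le_sum_abs _ _).trans ((Finset.sum_le_sum fun s _ => h _).trans ?_)
  rw [Finset.sum_const, Nat.card_Ico, nsmul_eq_mul]
  gcongr
  omega

/-- Choose one index from each of three consecutive blocks of length `n / 3`. Rounding costs at most
`n ≤ 6 * (n / 3)`, hence `216 = 6 ^ 3`. -/
lemma card_triplets_ge {n : ℕ} (hn : 3 ≤ n) : (n : ℝ) ^ 3 / 216 ≤ (triplets n).card := by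
  have h : Fintype.card (Fin (n / 3) × Fin (n / 3) × Fin (n / 3)) ≤ (triplets n).card := by
    rw [← Finset.card_univ]
    refine Finset.card_le_card_of_injOn (fun x =>
      ((⟨x.1, by omega⟩ : Fin n), (⟨n / 3 + x.2.1, by omega⟩ : Fin n),
        (⟨2 * (n / 3) + x.2.2, by omega⟩ : Fin n))) ?_ ?_
    · intro x _
      simp only [triplets, Finset.coe_filter, Finset.mem_univ, true_and, Set.mem_ofPred_eq,
        Fin.mk_lt_mk]
      omega
    · rintro ⟨a, b, c⟩ - ⟨a', b', c'⟩ - h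
      simp only [Prod.mk.injEq, Fin.ext_iff] at h ⊢
      omega
  simp only [Fintype.card_prod, Fintype.card_fin] at h
  have h6 : (n : ℝ) ≤ 6 * ((n / 3 : ℕ) : ℝ) := by
    exact_mod_cast (by omega : n ≤ 6 * (n / 3))
  have h' : ((n / 3 : ℕ) : ℝ) ^ 3 ≤ (triplets n).card := by
    calc ((n / 3 : ℕ) : ℝ) ^ 3 = ((n / 3 * (n / 3 * (n / 3)) : ℕ) : ℝ) := by push_cast; ring
      _ ≤ _ := by exact_mod_cast h
  have := pow_le_pow_left₀ (Nat.cast_nonneg n) h6 3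
  nlinarith

/-! ### The caterpillar tree. -/

/-- The nodes of the caterpillar: a path of `n` nodes, to each of which a leaf is attached. -/
inductive CaterpillarNode (n : ℕ) : Type
  | spine : Fin n → CaterpillarNode n
  | leaf : Fin n → CaterpillarNode n

namespace CaterpillarNode

variable {n : ℕ}

/-- The ancestor relation of the caterpillar. -/
def IsAncestor : CaterpillarNode n → CaterpillarNode n → Prop
  | spine i, spine j => i ≤ j
  | spine i, leaf j => i ≤ j
  | leaf _, spine _ => False
  | leaf i, leaf j => i = j

/-- The lowest common ancestor in the caterpillar. -/
def lca : CaterpillarNode n → CaterpillarNode n → CaterpillarNode n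
  | spine i, spine j => spine (min i j)
  | spine i, leaf j => spine (min i j)
  | leaf i, spine j => spine (min i j)
  | leaf i, leaf j => if i = j then leaf i else spine (min i j)

/-- The parent of a node of the caterpillar. -/
def parent : CaterpillarNode n → CaterpillarNode n
  -- Truncated subtraction makes the root its own predecessor.
  | spine i => spine ⟨i - 1, by omega⟩
  | leaf i => spine i

instance : SemilatticeInf (CaterpillarNode n) where
  le := IsAncestor
  le_refl := by rintro (i | i) <;> simp [IsAncestor]
  le_trans := by
    rintro (i | i) (j | j) (k | k) <;> simp only [IsAncestor] <;> grind
  le_antisymm := by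
    rintro (i | i) (j | j) <;> simp only [IsAncestor, spine.injEq, leaf.injEq] <;> grind
  inf := lca
  inf_le_left := by
    rintro (i | i) (j | j) <;> simp only [lca] <;> (try split_ifs) <;> simp [IsAncestor]
  inf_le_right := by
    rintro (i | i) (j | j) <;> simp only [lca] <;> (try split_ifs) <;> simp [IsAncestor, *]
  le_inf := by
    rintro (i | i) (j | j) (k | k) <;> simp only [lca] <;> (try split_ifs) <;>
      simp only [IsAncestor, le_min_iff] <;> grind

lemma le_def {x y : CaterpillarNode n} : x ≤ y ↔ IsAncestor x y := Iff.rfl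

instance [NeZero n] : OrderBot (CaterpillarNode n) where
  bot := spine 0
  bot_le := by rintro (i | i) <;> simp [le_def, IsAncestor]

instance : PredOrder (CaterpillarNode n) where
  pred := parent
  pred_le := by
    rintro (i | i) <;> simp [le_def, IsAncestor, parent, Fin.le_def]
  min_of_le_pred := by
    rintro (i | i) h (j | j) h' <;>
      (simp only [le_def, IsAncestor, parent, Fin.le_def] at h h' ⊢; try omega)
  le_pred_of_lt := by
    rintro (i | i) (j | j) h <;> rw [lt_iff_le_not_ge] at h <;>
      simp only [le_def, IsAncestor, parent, Fin.le_def, Fin.ext_iff] at h ⊢ <;> grind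

lemma pred_iterate_spine (j : Fin n) (k : ℕ) :
    Order.pred^[k] (spine j) = spine ⟨j - k, by omega⟩ := by
  induction k with
  | zero => rfl
  | succ k ih =>
    rw [Function.iterate_succ_apply', ih]
    change spine _ = _
    congr 2

instance : IsPredArchimedean (CaterpillarNode n) where
  exists_pred_iterate_of_le := by
    have key : ∀ i j : Fin n, i ≤ j → Order.pred^[(j : ℕ) - i] (spine j) = spine i := by
      intro i j h
      rw [pred_iterate_spine]
      congr 1
      exact Fin.ext (Nat.sub_sub_self h)
    rintro (i | i) (j | j) h
    · exact ⟨_, key i j h⟩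
    · exact ⟨(j : ℕ) - i + 1, key i j h⟩
    · exact h.elim
    · exact ⟨0, by cases h; rfl⟩

end CaterpillarNode

open CaterpillarNode in
/-- The caterpillar as an HC-tree. -/
noncomputable def caterpillar (n : ℕ) [NeZero n] : HCTree n where
  tree := ⟨CaterpillarNode n⟩
  finite_tree :=
    Finite.of_surjective (fun o : Fin n ⊕ Fin n => o.elim spine leaf) (by
      rintro (i | i)
      · exact ⟨.inl i, rfl⟩
      · exact ⟨.inr i, rfl⟩)
  leaf := leaf
  leaf_injective _ _ h := leaf.inj h
  range_leaf := by
    ext x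
    constructor
    · rintro ⟨i, rfl⟩ (j | j) h
      · exact h.elim
      · exact Eq.symm h
    · intro hx
      cases x with
      | spine i => exact (hx (b := leaf i) (le_refl i)).elim
      | leaf i => exact ⟨i, rfl⟩

/-- The leaves `j` and `k` meet at spine node `j`, strictly below the node carrying leaf `i`. Hence
every triplet is resolved and pays only two weights. -/
lemma caterpillar_merges {n : ℕ} [NeZero n] {i j k : Fin n} (hij : i < j) (hjk : j < k) :
    (caterpillar n).Merges j k i := by
  rw [HCTree.merges_iff]
  intro h
  change CaterpillarNode.IsAncestor (CaterpillarNode.lca (.leaf j) (.leaf k)) (.leaf i) at h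
  rw [CaterpillarNode.lca, if_neg hjk.ne, min_eq_left hjk.le] at h
  exact hij.not_ge h

/-! ### Deterministic bounds for total and base costs. -/

lemma mem_triplets {n : ℕ} {t : Fin n × Fin n × Fin n} :
    t ∈ triplets n ↔ t.1 < t.2.1 ∧ t.2.1 < t.2.2 := by
  simp [triplets]

lemma totalCost_caterpillar_const {n : ℕ} [NeZero n] (p : ℝ) :
    totalCost (Matrix.of fun _ _ => p) (caterpillar n) = 2 * p * (triplets n).card := by
  unfold totalCost
  rw [Finset.sum_congr rfl (g := fun _ => 2 * p), Finset.sum_const, nsmul_eq_mul, mul_comm]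
  intro t ht
  rw [mem_triplets] at ht
  have h := caterpillar_merges ht.1 ht.2
  unfold tripletCost
  simp only [Matrix.of_apply, if_pos h]
  split_ifs <;> ring

lemma baseCost_const {n : ℕ} (p : ℝ) :
    baseCost (Matrix.of fun _ _ : Fin n => p) = 2 * p * (triplets n).card := by
  simp only [baseCost, minTripletCost, Matrix.of_apply, min_self, Finset.sum_const, nsmul_eq_mul]
  ring

lemma minTripletCost_le_tripletCost {n : ℕ} {w : Matrix (Fin n) (Fin n) ℝ} (T : HCTree n)
    {i j k : Fin n} (hij : 0 ≤ w i j) :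
    minTripletCost w i j k ≤ tripletCost w T i j k := by
  unfold minTripletCost tripletCost
  split_ifs
  · exact (min_le_right _ _).trans (min_le_right _ _)
  · exact (min_le_right _ _).trans (min_le_left _ _)
  · exact min_le_left _ _
  -- Only an unresolved triplet, paying all three weights, needs nonnegativity.
  · exact (min_le_right _ _).trans ((min_le_right _ _).trans (by linarith))

lemma baseCost_le_totalCost {n : ℕ} {w : Matrix (Fin n) (Fin n) ℝ}
    (hw : ∀ i j, i ≠ j → 0 ≤ w i j) (T : HCTree n) : baseCost w ≤ totalCost w T :=
  Finset.sum_le_sum fun _ ht =>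
    minTripletCost_le_tripletCost T (hw _ _ (mem_triplets.1 ht).1.ne)

lemma le_baseCost {n : ℕ} {w : Matrix (Fin n) (Fin n) ℝ} {q : ℝ}
    (hw : ∀ i j, i ≠ j → q ≤ w i j) : 2 * q * (triplets n).card ≤ baseCost w := by
  rw [mul_comm, ← nsmul_eq_mul]
  refine Finset.card_nsmul_le_sum _ _ _ fun _ ht => ?_
  rw [mem_triplets] at ht
  have h1 := hw _ _ ht.1.ne
  have h2 := hw _ _ ht.2.ne
  have h3 := hw _ _ (ht.1.trans ht.2).ne
  exact le_min (by linarith) (le_min (by linarith) (by linarith))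

lemma triplets_nonempty {n : ℕ} (hn : 3 ≤ n) : (triplets n).Nonempty :=
  ⟨(⟨0, by omega⟩, ⟨1, by omega⟩, ⟨2, by omega⟩), mem_triplets.2 (by simp)⟩

lemma baseCost_pos {n : ℕ} (hn : 3 ≤ n) {w : Matrix (Fin n) (Fin n) ℝ}
    (hw : ∀ i j, i ≠ j → 0 < w i j) : 0 < baseCost w := by
  refine Finset.sum_pos (fun _ ht => ?_) (triplets_nonempty hn)
  rw [mem_triplets] at ht
  have h1 := hw _ _ ht.1.ne
  have h2 := hw _ _ ht.2.ne
  have h3 := hw _ _ (ht.1.trans ht.2).ne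
  exact lt_min (by linarith) (lt_min (by linarith) (by linarith))

lemma ratioCost_of_ne_zero {n : ℕ} {w : Matrix (Fin n) (Fin n) ℝ} (h : baseCost w ≠ 0)
    (T : HCTree n) : ratioCost w T = ((totalCost w T / baseCost w : ℝ) : EReal) := by
  unfold ratioCost
  rw [if_neg h]

lemma IsOptimalTree.totalCost_le {n : ℕ} {w : Matrix (Fin n) (Fin n) ℝ} {T : HCTree n}
    (hT : IsOptimalTree w T) (h : 0 < baseCost w) (T' : HCTree n) :
    totalCost w T ≤ totalCost w T' := by
  have := hT T'
  rw [ratioCost_of_ne_zero h.ne', ratioCost_of_ne_zero h.ne', EReal.coe_le_coe_iff] at this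
  exact (div_le_div_iff_of_pos_right h).1 this

lemma IsOptimalTree.optRatioCost_eq {n : ℕ} {w : Matrix (Fin n) (Fin n) ℝ} {T : HCTree n}
    (hT : IsOptimalTree w T) : optRatioCost w = ratioCost w T :=
  le_antisymm (iInf_le _ T) (le_iInf hT)

/-- The optimum is squeezed between the base cost and the cost of the caterpillar, which coincide.
-/
lemma IsOptimalTree.totalCost_const {n : ℕ} (hn : 3 ≤ n) {p : ℝ} (hp : 0 < p) {T : HCTree n}
    (hT : IsOptimalTree (Matrix.of fun _ _ => p) T) :
    totalCost (Matrix.of fun _ _ => p) T = 2 * p * (triplets n).card := by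
  have : NeZero n := ⟨by omega⟩
  refine le_antisymm ?_ ?_
  · rw [← totalCost_caterpillar_const]
    exact hT.totalCost_le (baseCost_pos hn fun _ _ _ => hp) _
  · rw [← baseCost_const]
    exact baseCost_le_totalCost (fun _ _ _ => hp.le) T

/-! ### The expected base cost. -/

lemma unitWeight_eq_zero_or_one {n : ℕ} (G : SimpleGraph (Fin n)) (i j : Fin n) :
    unitWeight G i j = 0 ∨ unitWeight G i j = 1 := by
  unfold unitWeight
  rw [Matrix.of_apply]
  split_ifs <;> simp

lemma unitWeight_mem_Icc {n : ℕ} (G : SimpleGraph (Fin n)) (i j : Fin n) :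
    unitWeight G i j ∈ Set.Icc (0 : ℝ) 1 := by
  rcases unitWeight_eq_zero_or_one G i j with h | h <;> simp [h]

/-- For 0/1 weights the minimum is 0, 0, 1, 2 for 0, 1, 2, 3 edges. This multilinear form lets
independence evaluate the expectation. -/
lemma minTripletCost_unitWeight {n : ℕ} (G : SimpleGraph (Fin n)) (i j k : Fin n) :
    minTripletCost (unitWeight G) i j k =
      unitWeight G i j * unitWeight G i k + unitWeight G i j * unitWeight G j k
        + unitWeight G i k * unitWeight G j k
        - unitWeight G i j * unitWeight G i k * unitWeight G j k := by
  unfold minTripletCost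
  rcases unitWeight_eq_zero_or_one G i j with h | h <;>
  rcases unitWeight_eq_zero_or_one G i k with h' | h' <;>
  rcases unitWeight_eq_zero_or_one G j k with h'' | h'' <;>
  rw [h, h', h''] <;> norm_num

lemma minTripletCost_unitWeight_mem_Icc {n : ℕ} (G : SimpleGraph (Fin n)) (i j k : Fin n) :
    minTripletCost (unitWeight G) i j k ∈ Set.Icc (0 : ℝ) 2 := by
  obtain ⟨h1, h1'⟩ := unitWeight_mem_Icc G i j
  obtain ⟨h2, h2'⟩ := unitWeight_mem_Icc G i k
  obtain ⟨h3, h3'⟩ := unitWeight_mem_Icc G j k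
  exact ⟨le_min (by linarith) (le_min (by linarith) (by linarith)),
    (min_le_left _ _).trans (by linarith)⟩

lemma unitWeight_eq_indicator {n : ℕ} {Ω : Type*} (G : Ω → SimpleGraph (Fin n)) (i j : Fin n) :
    (fun ω => unitWeight (G ω) i j)
      = Set.indicator {ω | (G ω).Adj i j} fun _ => (1 : ℝ) := by
  ext ω
  by_cases h : (G ω).Adj i j <;> simp [unitWeight, h]

/-- The pairs `i < j`. -/
abbrev Pair (n : ℕ) : Type := {e : Fin n × Fin n // e.1 < e.2}

namespace IsRandomGraph

variable {n : ℕ} {Ω : Type*} [MeasurableSpace Ω] {P : Matrix (Fin n) (Fin n) ℝ}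
  {μ : Measure Ω} {G : Ω → SimpleGraph (Fin n)}

lemma measurableSet_adj (hG : IsRandomGraph P μ G) (i j : Fin n) :
    MeasurableSet {ω | (G ω).Adj i j} :=
  measurableSet_setOfPred.2 (SimpleGraph.measurable_iff_adj.1 hG.measurable i j)

lemma measurable_unitWeight (hG : IsRandomGraph P μ G) (i j : Fin n) :
    Measurable fun ω => unitWeight (G ω) i j := by
  rw [unitWeight_eq_indicator]
  exact measurable_const.indicator (hG.measurableSet_adj i j)

lemma integral_unitWeight (hG : IsRandomGraph P μ G) {i j : Fin n} (hij : i ≠ j) :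
    ∫ ω, unitWeight (G ω) i j ∂μ = P i j := by
  rw [unitWeight_eq_indicator, integral_indicator_const _ (hG.measurableSet_adj i j),
    hG.prob_adj i j hij, smul_eq_mul, mul_one]

lemma iIndepFun_unitWeight (hG : IsRandomGraph P μ G) :
    iIndepFun (fun (e : Pair n) ω => unitWeight (G ω) e.1.1 e.1.2) μ := by
  have h : (fun (e : Pair n) ω => unitWeight (G ω) e.1.1 e.1.2)
      = fun e : Pair n => Set.indicator {ω | (G ω).Adj e.1.1 e.1.2} fun _ => (1 : ℝ) :=
    funext fun e => unitWeight_eq_indicator G _ _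
  rw [h]
  exact hG.indep.iIndepFun_indicator

lemma integral_mul (hG : IsRandomGraph P μ G) {e e' : Pair n} (h : e ≠ e') :
    ∫ ω, unitWeight (G ω) e.1.1 e.1.2 * unitWeight (G ω) e'.1.1 e'.1.2 ∂μ
      = P e.1.1 e.1.2 * P e'.1.1 e'.1.2 := by
  rw [(hG.iIndepFun_unitWeight.indepFun h).integral_fun_mul_eq_mul_integral
    (hG.measurable_unitWeight _ _).aestronglyMeasurable
    (hG.measurable_unitWeight _ _).aestronglyMeasurable,
    hG.integral_unitWeight e.2.ne, hG.integral_unitWeight e'.2.ne]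

lemma integral_mul_mul (hG : IsRandomGraph P μ G) {e e' e'' : Pair n} (h : e ≠ e')
    (h' : e ≠ e'') (h'' : e' ≠ e'') :
    ∫ ω, unitWeight (G ω) e.1.1 e.1.2 * unitWeight (G ω) e'.1.1 e'.1.2
        * unitWeight (G ω) e''.1.1 e''.1.2 ∂μ
      = P e.1.1 e.1.2 * P e'.1.1 e'.1.2 * P e''.1.1 e''.1.2 := by
  have hm : ∀ e : Pair n, Measurable fun ω => unitWeight (G ω) e.1.1 e.1.2 :=
    fun e => hG.measurable_unitWeight _ _
  have hind := (hG.iIndepFun_unitWeight.indepFun_prodMk hm e e' e'' h' h'').comp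
    (φ := fun x : ℝ × ℝ => x.1 * x.2) (ψ := id) (by fun_prop) measurable_id
  have := hind.integral_fun_mul_eq_mul_integral
    ((hm e).mul (hm e')).aestronglyMeasurable (hm e'').aestronglyMeasurable
  simp only [Function.comp_def, id] at this
  rw [this, hG.integral_mul h, hG.integral_unitWeight e''.2.ne]

lemma measurable_minTripletCost (hG : IsRandomGraph P μ G) (i j k : Fin n) :
    Measurable fun ω => minTripletCost (unitWeight (G ω)) i j k := by
  unfold minTripletCost
  have := hG.measurable_unitWeight
  fun_prop

variable [IsProbabilityMeasure μ]

lemma memLp_minTripletCost (hG : IsRandomGraph P μ G) (i j k : Fin n) (p : ENNReal) :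
    MemLp (fun ω => minTripletCost (unitWeight (G ω)) i j k) p μ :=
  memLp_of_bounded (Eventually.of_forall fun _ => minTripletCost_unitWeight_mem_Icc _ _ _ _)
    (hG.measurable_minTripletCost i j k).aestronglyMeasurable p

lemma integrable_minTripletCost (hG : IsRandomGraph P μ G) (i j k : Fin n) :
    Integrable (fun ω => minTripletCost (unitWeight (G ω)) i j k) μ :=
  memLp_one_iff_integrable.1 (hG.memLp_minTripletCost i j k 1)

lemma integral_minTripletCost (hG : IsRandomGraph P μ G) {i j k : Fin n} (hij : i < j)
    (hjk : j < k) :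
    ∫ ω, minTripletCost (unitWeight (G ω)) i j k ∂μ
      = P i j * P i k + P i j * P j k + P i k * P j k - P i j * P i k * P j k := by
  have hik := hij.trans hjk
  have hint : ∀ f : Ω → ℝ, Measurable f → (∀ ω, f ω ∈ Set.Icc (0 : ℝ) 1) → Integrable f μ :=
    fun f hf hb => Integrable.of_mem_Icc 0 1 hf.aemeasurable (Eventually.of_forall hb)
  have hm := hG.measurable_unitWeight
  have hb : ∀ (i j : Fin n) ω, unitWeight (G ω) i j ∈ Set.Icc (0 : ℝ) 1 :=
    fun i j ω => unitWeight_mem_Icc _ i j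
  have hmul : ∀ {x y : ℝ}, x ∈ Set.Icc (0 : ℝ) 1 → y ∈ Set.Icc (0 : ℝ) 1 →
      x * y ∈ Set.Icc (0 : ℝ) 1 :=
    fun hx hy => ⟨mul_nonneg hx.1 hy.1, mul_le_one₀ hx.2 hy.1 hy.2⟩
  have i1 := hint _ ((hm i j).mul (hm i k)) fun ω => hmul (hb i j ω) (hb i k ω)
  have i2 := hint _ ((hm i j).mul (hm j k)) fun ω => hmul (hb i j ω) (hb j k ω)
  have i3 := hint _ ((hm i k).mul (hm j k)) fun ω => hmul (hb i k ω) (hb j k ω)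
  have i4 := hint _ (((hm i j).mul (hm i k)).mul (hm j k))
    fun ω => hmul (hmul (hb i j ω) (hb i k ω)) (hb j k ω)
  have n1 : (⟨(i, j), hij⟩ : Pair n) ≠ ⟨(i, k), hik⟩ := by simp [hjk.ne]
  have n2 : (⟨(i, j), hij⟩ : Pair n) ≠ ⟨(j, k), hjk⟩ := by simp [hij.ne]
  have n3 : (⟨(i, k), hik⟩ : Pair n) ≠ ⟨(j, k), hjk⟩ := by simp [hij.ne]
  simp only [minTripletCost_unitWeight]
  refine (integral_sub ((i1.add i2).add i3) i4).trans
    (congrArg₂ _ ((integral_add (i1.add i2) i3).trans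
      (congrArg₂ _ ((integral_add i1 i2).trans
        (congrArg₂ _ (hG.integral_mul n1) (hG.integral_mul n2))) (hG.integral_mul n3)))
      (hG.integral_mul_mul n1 n2 n3))

lemma expBaseCost_eq_sum (hG : IsRandomGraph P μ G) :
    expBaseCost μ G
      = ∑ t ∈ triplets n, ∫ ω, minTripletCost (unitWeight (G ω)) t.1 t.2.1 t.2.2 ∂μ := by
  unfold expBaseCost baseCost
  rw [integral_finsetSum _ fun t _ => hG.integrable_minTripletCost _ _ _]

/-- A lower bound for the expected base cost. -/
lemma le_expBaseCost (hG : IsRandomGraph P μ G) {q : ℝ} (hq : 0 ≤ q)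
    (hP : ∀ i j, i ≠ j → q ≤ P i j ∧ P i j ≤ 1) :
    q ^ 2 * (triplets n).card ≤ expBaseCost μ G := by
  rw [hG.expBaseCost_eq_sum, mul_comm, ← nsmul_eq_mul]
  refine Finset.card_nsmul_le_sum _ _ _ fun t ht => ?_
  rw [mem_triplets] at ht
  rw [hG.integral_minTripletCost ht.1 ht.2]
  obtain ⟨h1, h1'⟩ := hP _ _ ht.1.ne
  obtain ⟨h2, h2'⟩ := hP _ _ ht.2.ne
  obtain ⟨h3, h3'⟩ := hP _ _ (ht.1.trans ht.2).ne
  have e1 : q ^ 2 ≤ P t.1 t.2.1 * P t.1 t.2.2 := by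
    rw [sq]; exact mul_le_mul h1 h3 hq (hq.trans h1)
  have e2 : 0 ≤ P t.1 t.2.1 * P t.2.1 t.2.2 := mul_nonneg (hq.trans h1) (hq.trans h2)
  -- The third product absorbs the cubic term, so the first product alone gives `q ^ 2`.
  have e3 : 0 ≤ P t.1 t.2.2 * P t.2.1 t.2.2 * (1 - P t.1 t.2.1) :=
    mul_nonneg (mul_nonneg (hq.trans h3) (hq.trans h2)) (sub_nonneg.2 h1')
  nlinarith

/-- For a non-degenerate random graph the expected base cost is strictly smaller than the base cost
of the expectation graph. -/
lemma expBaseCost_lt_baseCost (hG : IsRandomGraph P μ G) (hn : 3 ≤ n)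
    (hP : ∀ i j, i ≠ j → 0 < P i j ∧ P i j < 1) : expBaseCost μ G < baseCost P := by
  -- The gap is exactly `(1 - z) * x + (1 - z) * y * (1 - x)`.
  have key : ∀ x y z : ℝ, 0 < x → 0 < y → z < 1 → x ≤ 1 →
      x * y + x * z + y * z - x * y * z < x + y := by
    intro x y z hx hy hz hx1
    nlinarith [mul_pos (sub_pos.2 hz) hx, mul_nonneg (mul_nonneg (sub_pos.2 hz).le hy.le)
      (sub_nonneg.2 hx1)]
  rw [hG.expBaseCost_eq_sum]
  refine Finset.sum_lt_sum_of_nonempty (triplets_nonempty hn) fun t ht => ?_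
  rw [mem_triplets] at ht
  rw [hG.integral_minTripletCost ht.1 ht.2]
  obtain ⟨h1, h1'⟩ := hP _ _ ht.1.ne
  obtain ⟨h2, h2'⟩ := hP _ _ ht.2.ne
  obtain ⟨h3, h3'⟩ := hP _ _ (ht.1.trans ht.2).ne
  refine lt_min ?_ (lt_min ?_ ?_)
  · linarith [key _ _ _ h1 h3 h2' h1'.le]
  · linarith [key _ _ _ h1 h2 h3' h1'.le]
  · linarith [key _ _ _ h3 h2 h1' h3'.le]

lemma expBaseCost_pos (hG : IsRandomGraph P μ G) (hn : 3 ≤ n)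
    (hP : ∀ i j, i ≠ j → 0 < P i j ∧ P i j < 1) : 0 < expBaseCost μ G := by
  rw [hG.expBaseCost_eq_sum]
  refine Finset.sum_pos (fun t ht => ?_) (triplets_nonempty hn)
  rw [mem_triplets] at ht
  rw [hG.integral_minTripletCost ht.1 ht.2]
  obtain ⟨h1, h1'⟩ := hP _ _ ht.1.ne
  obtain ⟨h2, h2'⟩ := hP _ _ ht.2.ne
  obtain ⟨h3, h3'⟩ := hP _ _ (ht.1.trans ht.2).ne
  nlinarith [mul_pos h1 h3, mul_pos h1 h2, mul_pos (mul_pos h3 h2) (sub_pos.2 h1')]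

lemma expBaseCost_const {p : ℝ} (hG : IsRandomGraph (Matrix.of fun _ _ => p) μ G) :
    expBaseCost μ G = (3 * p ^ 2 - p ^ 3) * (triplets n).card := by
  rw [hG.expBaseCost_eq_sum, Finset.sum_congr rfl (g := fun _ => 3 * p ^ 2 - p ^ 3),
    Finset.sum_const, nsmul_eq_mul, mul_comm]
  intro t ht
  rw [mem_triplets] at ht
  rw [hG.integral_minTripletCost ht.1 ht.2]
  simp only [Matrix.of_apply]
  ring

end IsRandomGraph

/-! ### Concentration of the base cost and of the cut weights. -/

lemma cutWeight_eq_sum_pair {n : ℕ} (w : Matrix (Fin n) (Fin n) ℝ) (f : Fin n → Fin n) :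
    cutWeight w f
      = ∑ e ∈ Finset.univ.filter (fun e : Pair n => f e.1.1 ≠ f e.1.2), w e.1.1 e.1.2 := by
  unfold cutWeight
  rw [Finset.sum_filter, ← Fintype.sum_prod_type'
    (f := fun i j : Fin n => if i < j then (if f i ≠ f j then w i j else 0) else 0),
    ← Finset.sum_filter]
  exact Finset.sum_subtype _ (by simp) fun x : Fin n × Fin n =>
    if f x.1 ≠ f x.2 then w x.1 x.2 else 0

/-- The pairs that are contained in a triplet. -/
def tripletPairs {n : ℕ} (t : Fin n × Fin n × Fin n) : Finset (Pair n) :=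
  Finset.univ.filter fun e =>
    e.1 = (t.1, t.2.1) ∨ e.1 = (t.1, t.2.2) ∨ e.1 = (t.2.1, t.2.2)

/-- The pair can occupy three positions in a sorted triplet, and the remaining entry has at most `n`
values. -/
lemma card_triplets_mem_le {n : ℕ} (e : Fin n × Fin n) :
    ((triplets n).filter fun t =>
      e = (t.1, t.2.1) ∨ e = (t.1, t.2.2) ∨ e = (t.2.1, t.2.2)).card ≤ 3 * n := by
  classical
  have hsub : ((triplets n).filter fun t =>
      e = (t.1, t.2.1) ∨ e = (t.1, t.2.2) ∨ e = (t.2.1, t.2.2))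
      ⊆ Finset.univ.image (fun c : Fin n => (e.1, e.2, c))
        ∪ (Finset.univ.image (fun c : Fin n => (e.1, c, e.2))
        ∪ Finset.univ.image fun c : Fin n => (c, e.1, e.2)) := by
    rintro ⟨i, j, k⟩ ht
    simp only [Finset.mem_filter] at ht
    rcases ht.2 with rfl | rfl | rfl <;> simp
  have hc : ∀ g : Fin n → Fin n × Fin n × Fin n, (Finset.univ.image g).card ≤ n := fun g =>
    Finset.card_image_le.trans_eq (by simp)
  calc _ ≤ _ := Finset.card_le_card hsub
    _ ≤ n + (n + n) := (Finset.card_union_le _ _).trans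
      (add_le_add (hc _) ((Finset.card_union_le _ _).trans (add_le_add (hc _) (hc _))))
    _ = 3 * n := by ring

/-- At most `9 n` triplets share a pair with a given triplet. -/
lemma card_not_disjoint_le {n : ℕ} (t : Fin n × Fin n × Fin n) :
    ((triplets n).filter fun t' => ¬ Disjoint (tripletPairs t) (tripletPairs t')).card
      ≤ 9 * n := by
  classical
  set A : Fin n × Fin n → Finset (Fin n × Fin n × Fin n) := fun e =>
    (triplets n).filter fun t => e = (t.1, t.2.1) ∨ e = (t.1, t.2.2) ∨ e = (t.2.1, t.2.2)
  have hsub : ((triplets n).filter fun t' => ¬ Disjoint (tripletPairs t) (tripletPairs t'))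
      ⊆ A (t.1, t.2.1) ∪ (A (t.1, t.2.2) ∪ A (t.2.1, t.2.2)) := by
    intro t' ht'
    rw [Finset.mem_filter, Finset.not_disjoint_iff] at ht'
    obtain ⟨h, e, he, he'⟩ := ht'
    simp only [tripletPairs, Finset.mem_filter, Finset.mem_univ, true_and] at he he'
    simp only [A, Finset.mem_union, Finset.mem_filter, h, true_and]
    rcases he with he | he | he <;> rw [he] at he' <;> tauto
  calc _ ≤ _ := Finset.card_le_card hsub
    _ ≤ 3 * n + (3 * n + 3 * n) := (Finset.card_union_le _ _).trans
      (add_le_add (card_triplets_mem_le _) ((Finset.card_union_le _ _).trans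
        (add_le_add (card_triplets_mem_le _) (card_triplets_mem_le _))))
    _ = 9 * n := by ring

namespace IsRandomGraph

variable {n : ℕ} {Ω : Type*} [MeasurableSpace Ω] {P : Matrix (Fin n) (Fin n) ℝ}
  {μ : Measure Ω} {G : Ω → SimpleGraph (Fin n)}

/-- Each cost is a measurable function of the edges in its own `tripletPairs`, and disjoint blocks
of independent edges are independent. -/
lemma indepFun_minTripletCost (hG : IsRandomGraph P μ G) {t t' : Fin n × Fin n × Fin n}
    (ht : t ∈ triplets n) (ht' : t' ∈ triplets n)
    (h : Disjoint (tripletPairs t) (tripletPairs t')) :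
    IndepFun (fun ω => minTripletCost (unitWeight (G ω)) t.1 t.2.1 t.2.2)
      (fun ω => minTripletCost (unitWeight (G ω)) t'.1 t'.2.1 t'.2.2) μ := by
  have hind := hG.iIndepFun_unitWeight.indepFun_finset _ _ h
    fun e => hG.measurable_unitWeight _ _
  have key : ∀ t ∈ triplets n, ∃ φ : (tripletPairs t → ℝ) → ℝ, Measurable φ ∧
      (fun ω => minTripletCost (unitWeight (G ω)) t.1 t.2.1 t.2.2)
        = φ ∘ fun ω (e : tripletPairs t) => unitWeight (G ω) e.1.1.1 e.1.1.2 := by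
    intro t ht
    rw [mem_triplets] at ht
    let a : tripletPairs t := ⟨⟨(t.1, t.2.1), ht.1⟩, by simp [tripletPairs]⟩
    let b : tripletPairs t := ⟨⟨(t.1, t.2.2), ht.1.trans ht.2⟩, by simp [tripletPairs]⟩
    let c : tripletPairs t := ⟨⟨(t.2.1, t.2.2), ht.2⟩, by simp [tripletPairs]⟩
    exact ⟨fun x => min (x a + x b) (min (x a + x c) (x b + x c)), by fun_prop, rfl⟩
  obtain ⟨φ, hφ, e⟩ := key t ht
  obtain ⟨ψ, hψ, e'⟩ := key t' ht'
  rw [e, e']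
  exact hind.comp hφ hψ

variable [IsProbabilityMeasure μ]

/-- Covariances vanish for triplets without a common pair. Each triplet has at most `9 n` other
partners (itself included), and since costs lie in `[0, 2]` each such covariance is at most twice
the mean. -/
lemma variance_baseCost_le (hG : IsRandomGraph P μ G) :
    Var[fun ω => baseCost (unitWeight (G ω)); μ] ≤ 18 * n * expBaseCost μ G := by
  classical
  set X : Fin n × Fin n × Fin n → Ω → ℝ := fun t ω =>
    minTripletCost (unitWeight (G ω)) t.1 t.2.1 t.2.2
  have hL : ∀ t, MemLp (X t) 2 μ := fun t => hG.memLp_minTripletCost _ _ _ 2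
  have hI : ∀ t, Integrable (X t) μ := fun t => hG.integrable_minTripletCost _ _ _
  have hb : ∀ t ω, X t ω ∈ Set.Icc (0 : ℝ) 2 := fun t ω =>
    minTripletCost_unitWeight_mem_Icc _ _ _ _
  have hE : ∀ t, 0 ≤ ∫ ω, X t ω ∂μ := fun t => integral_nonneg fun ω => (hb t ω).1
  have hcov : ∀ t t', cov[X t, X t'; μ] ≤ 2 * ∫ ω, X t ω ∂μ := by
    intro t t'
    rw [covariance_eq_sub (hL t) (hL t')]
    have h1 : ∫ ω, (X t * X t') ω ∂μ ≤ ∫ ω, 2 * X t ω ∂μ := by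
      refine integral_mono ((hL t).integrable_mul (hL t')) ((hI t).const_mul 2) fun ω => ?_
      have := mul_le_mul_of_nonneg_left (hb t' ω).2 (hb t ω).1
      simp only [Pi.mul_apply]
      linarith
    rw [integral_const_mul] at h1
    have h2 := mul_nonneg (hE t) (hE t')
    linarith
  have hvar : Var[fun ω => baseCost (unitWeight (G ω)); μ]
      = ∑ t ∈ triplets n, ∑ t' ∈ triplets n, cov[X t, X t'; μ] :=
    variance_fun_sum' fun t _ => hL t
  rw [hvar, hG.expBaseCost_eq_sum, Finset.mul_sum]
  refine Finset.sum_le_sum fun t ht => ?_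
  calc ∑ t' ∈ triplets n, cov[X t, X t'; μ]
      ≤ ∑ t' ∈ triplets n, if ¬ Disjoint (tripletPairs t) (tripletPairs t') then
          2 * ∫ ω, X t ω ∂μ else 0 := by
        refine Finset.sum_le_sum fun t' ht' => ?_
        split_ifs with h
        · exact ((hG.indepFun_minTripletCost ht ht' h).covariance_eq_zero (hL t) (hL t')).le
        · exact hcov t t'
    _ = ((triplets n).filter fun t' =>
          ¬ Disjoint (tripletPairs t) (tripletPairs t')).card * (2 * ∫ ω, X t ω ∂μ) := by
        rw [← Finset.sum_filter, Finset.sum_const, nsmul_eq_mul]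
    _ ≤ (9 * n : ℕ) * (2 * ∫ ω, X t ω ∂μ) := by
        have := hE t
        have := card_not_disjoint_le t
        gcongr
    _ = 18 * n * ∫ ω, X t ω ∂μ := by push_cast; ring

/-- Concentration of the base cost. -/
lemma measureReal_baseCost_le (hG : IsRandomGraph P μ G) {η : ℝ} (hη : 0 < η)
    (hpos : 0 < expBaseCost μ G) :
    μ.real {ω | η * expBaseCost μ G ≤ |baseCost (unitWeight (G ω)) - expBaseCost μ G|}
      ≤ 18 * n / (η ^ 2 * expBaseCost μ G) := by
  have hL : MemLp (fun ω => baseCost (unitWeight (G ω))) 2 μ :=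
    memLp_finsetSum _ fun t _ => hG.memLp_minTripletCost _ _ _ 2
  have h := meas_ge_le_variance_div_sq hL (mul_pos hη hpos)
  have h' := ENNReal.toReal_le_of_le_ofReal
    (div_nonneg (variance_nonneg _ _) (sq_nonneg _)) h
  refine h'.trans ?_
  calc _ ≤ 18 * n * expBaseCost μ G / (η * expBaseCost μ G) ^ 2 := by
        gcongr
        exact hG.variance_baseCost_le
    _ = _ := by field_simp

/-- Hoeffding's inequality for the pairs separated by a fixed partition. -/
lemma measureReal_cutWeight_le (hG : IsRandomGraph P μ G) (f : Fin n → Fin n) {t : ℝ}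
    (ht : 0 < t) :
    μ.real {ω | t ≤ |cutWeight (unitWeight (G ω)) f - cutWeight P f|}
      ≤ 2 * Real.exp (-2 * t ^ 2 / n ^ 2) := by
  set S := Finset.univ.filter (fun e : Pair n => f e.1.1 ≠ f e.1.2)
  set X : Pair n → Ω → ℝ := fun e ω => unitWeight (G ω) e.1.1 e.1.2 - P e.1.1 e.1.2
  have hdiff : ∀ ω, cutWeight (unitWeight (G ω)) f - cutWeight P f = ∑ e ∈ S, X e ω := by
    intro ω
    rw [cutWeight_eq_sum_pair, cutWeight_eq_sum_pair, ← Finset.sum_sub_distrib]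
  simp only [hdiff]
  -- With no separated pair the sub-Gaussian exponent would divide by zero and give only the bound
  -- 1, so this case is separate.
  rcases S.eq_empty_or_nonempty with hS0 | hS0
  · have : {ω | t ≤ |∑ e ∈ S, X e ω|} = ∅ := by
      ext ω
      simp [hS0, ht]
    rw [this, measureReal_empty]
    positivity
  have hind : iIndepFun X μ :=
    hG.iIndepFun_unitWeight.comp (fun e x => x - P e.1.1 e.1.2) fun e => by fun_prop
  have hind' : iIndepFun (fun e ω => - X e ω) μ :=
    hind.comp (fun _ x => -x) fun _ => measurable_neg
  -- Hoeffding's lemma: a centred variable with range of length 1 has parameter `1 / 4`. The sum has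
  -- parameter `S.card / 4`, and `S.card ≤ n ^ 2`.
  have hsub : ∀ e ∈ S, HasSubgaussianMGF (X e) ((‖(1 : ℝ) - 0‖₊ / 2) ^ 2) μ := by
    intro e _
    have := hasSubgaussianMGF_of_mem_Icc (μ := μ)
      (hG.measurable_unitWeight e.1.1 e.1.2).aemeasurable
      (Eventually.of_forall fun ω => unitWeight_mem_Icc (G ω) e.1.1 e.1.2)
    rwa [hG.integral_unitWeight e.2.ne] at this
  have hcard : (S.card : ℝ) ≤ n ^ 2 := by
    have h1 : S.card ≤ Fintype.card (Fin n × Fin n) :=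
      (Finset.card_le_univ _).trans (Fintype.card_subtype_le _)
    rw [Fintype.card_prod, Fintype.card_fin, ← sq] at h1
    exact_mod_cast h1
  have hcard0 : (0 : ℝ) < S.card := by exact_mod_cast hS0.card_pos
  have hexp : Real.exp (-t ^ 2 / (2 * ((∑ e ∈ S, (‖(1 : ℝ) - 0‖₊ / 2) ^ 2 : NNReal) : ℝ)))
      ≤ Real.exp (-2 * t ^ 2 / n ^ 2) := by
    rw [Real.exp_le_exp, Finset.sum_const, nsmul_eq_mul]
    simp only [sub_zero, nnnorm_one, NNReal.coe_mul, NNReal.coe_natCast, NNReal.coe_pow,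
      NNReal.coe_div, NNReal.coe_one, NNReal.coe_ofNat]
    have h1 : -t ^ 2 / (2 * ((S.card : ℝ) * (1 / 2) ^ 2)) = -(2 * t ^ 2 / S.card) := by
      field_simp
    rw [h1, neg_mul, neg_div, neg_le_neg_iff]
    gcongr
  have h1 := (HasSubgaussianMGF.measure_sum_ge_le_of_iIndepFun hind hsub ht.le).trans hexp
  have h2 := (HasSubgaussianMGF.measure_sum_ge_le_of_iIndepFun hind'
    (fun e he => (hsub e he).neg) ht.le).trans hexp
  calc μ.real {ω | t ≤ |∑ e ∈ S, X e ω|}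
      ≤ μ.real ({ω | t ≤ ∑ e ∈ S, X e ω} ∪ {ω | t ≤ ∑ e ∈ S, - X e ω}) := by
        refine measureReal_mono fun ω hω => ?_
        simp only [Set.mem_union, Set.mem_ofPred_eq, Finset.sum_neg_distrib] at hω ⊢
        exact le_abs.1 hω
    _ ≤ _ := (measureReal_union_le _ _).trans (by linarith)

/-- Uniform concentration over all partitions. -/
lemma measureReal_exists_cutWeight_le (hG : IsRandomGraph P μ G) {t : ℝ} (ht : 0 < t) :
    μ.real {ω | ∃ f, t ≤ |cutWeight (unitWeight (G ω)) f - cutWeight P f|}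
      ≤ n ^ n * (2 * Real.exp (-2 * t ^ 2 / n ^ 2)) := by
  have : {ω | ∃ f, t ≤ |cutWeight (unitWeight (G ω)) f - cutWeight P f|}
      = ⋃ f, {ω | t ≤ |cutWeight (unitWeight (G ω)) f - cutWeight P f|} := by
    ext ω
    simp
  rw [this]
  refine (measureReal_iUnion_fintype_le _).trans
    ((Finset.sum_le_sum fun f _ => hG.measureReal_cutWeight_le f ht).trans_eq ?_)
  simp

end IsRandomGraph

/-! ### From concentration to the optimal ratio cost. -/

/-- Closeness of all total costs and of the base costs implies closeness of the optimal ratio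
costs. -/
lemma optRatioCost_mem_Icc {n : ℕ} {w v : Matrix (Fin n) (Fin n) ℝ} {η E : ℝ} (hη : 0 < η)
    (hη' : η ≤ 1 / 2) (hE : 0 < E) (hb : |baseCost w - E| ≤ η * E)
    (hc : ∀ T, |totalCost w T - totalCost v T| ≤ η * totalCost v T) {T : HCTree n}
    (hT : ∀ T', totalCost v T ≤ totalCost v T') (hT0 : 0 ≤ totalCost v T) :
    (((1 - 4 * η) * (totalCost v T / E) : ℝ) : EReal) ≤ optRatioCost w ∧
      optRatioCost w ≤ (((1 + 4 * η) * (totalCost v T / E) : ℝ) : EReal) := by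
  rw [abs_le] at hb
  have hB1 : (1 - η) * E ≤ baseCost w := by linarith
  have hB2 : baseCost w ≤ (1 + η) * E := by linarith
  have hB0 : 0 < baseCost w := (mul_pos (by linarith) hE).trans_le hB1
  constructor
  · refine le_iInf fun T' => ?_
    rw [ratioCost_of_ne_zero hB0.ne', EReal.coe_le_coe_iff, ← mul_div_assoc,
      div_le_div_iff₀ hE hB0]
    have h := (abs_le.1 (hc T')).1
    have h2 : (1 - η) * totalCost v T ≤ totalCost w T' := by
      nlinarith [hT T']
    -- If `1 - 4 * η` is nonpositive the lower bound is trivial; its sign is needed to multiply by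
    -- the upper bound on the base cost.
    rcases le_total (1 - 4 * η) 0 with h4 | h4
    · refine (mul_nonpos_of_nonpos_of_nonneg (mul_nonpos_of_nonpos_of_nonneg h4 hT0)
        hB0.le).trans (mul_nonneg (le_trans (mul_nonneg (by linarith) hT0) h2) hE.le)
    · calc (1 - 4 * η) * totalCost v T * baseCost w
          ≤ (1 - 4 * η) * totalCost v T * ((1 + η) * E) := by gcongr
        _ = ((1 - 4 * η) * (1 + η)) * (totalCost v T * E) := by ring
        _ ≤ (1 - η) * (totalCost v T * E) := by
            gcongr
            nlinarith
        _ = (1 - η) * totalCost v T * E := by ring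
        _ ≤ totalCost w T' * E := by gcongr
  · refine (iInf_le _ T).trans ?_
    rw [ratioCost_of_ne_zero hB0.ne', EReal.coe_le_coe_iff, ← mul_div_assoc,
      div_le_div_iff₀ hB0 hE]
    have h := (abs_le.1 (hc T)).2
    calc totalCost w T * E ≤ (1 + η) * totalCost v T * E := by
          gcongr
          linarith
      _ = (1 + η) * (totalCost v T * E) := by ring
      -- This is where `η ≤ 1 / 2` is needed: the difference of the factors is `2 * η * (1 - 2 *
      -- η)`.
      _ ≤ ((1 + 4 * η) * (1 - η)) * (totalCost v T * E) := by
          gcongr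
          nlinarith
      _ = (1 + 4 * η) * totalCost v T * ((1 - η) * E) := by ring
      _ ≤ (1 + 4 * η) * totalCost v T * baseCost w := by gcongr

/-- If a property holds eventually for every error bound `1 / (m + 1)`, then it holds eventually
for error bounds tending to zero. -/
lemma exists_tendsto_zero_of_eventually {Q : ℕ → ℝ → Prop}
    (h : ∀ m : ℕ, ∀ᶠ n in atTop, Q n (1 / ((m : ℝ) + 1))) :
    ∃ δ : ℕ → ℝ, Tendsto δ atTop (nhds 0) ∧ ∀ᶠ n in atTop, Q n (δ n) := by
  classical
  let R : ℕ → ℕ → Prop := fun n m => ∀ n' ≥ n, Q n' (1 / ((m : ℝ) + 1))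
  -- Diagonal choice: the best bound valid from `n` on, with `m` capped by `n`.
  let g : ℕ → ℕ := fun n => Nat.findGreatest (R n) n
  have hR : ∀ m, ∀ᶠ n in atTop, R n m := by
    intro m
    obtain ⟨N, hN⟩ := eventually_atTop.1 (h m)
    exact eventually_atTop.2 ⟨N, fun n hn n' hn' => hN n' (hn.trans hn')⟩
  have hg : Tendsto g atTop atTop := by
    refine tendsto_atTop.2 fun m => ?_
    filter_upwards [hR m, eventually_ge_atTop m] with n hn hm
    exact Nat.le_findGreatest hm hn
  refine ⟨fun n => 1 / ((g n : ℝ) + 1), tendsto_one_div_add_atTop_nhds_zero_nat.comp hg, ?_⟩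
  -- Validity of `m = 0` ensures that `findGreatest` returns a genuine witness, not its default 0.
  filter_upwards [hR 0] with n hn
  exact Nat.findGreatest_spec (P := R n) (Nat.zero_le n) hn n le_rfl

/-- The success probability of the concentration event, for a graph whose edge probabilities are
at least `108 / η * √(log n / n)`. -/
lemma IsRandomGraph.lt_measureReal_optRatioCost {n : ℕ} {Ω : Type*} [MeasurableSpace Ω]
    {P : Matrix (Fin n) (Fin n) ℝ} {μ : Measure Ω} [IsProbabilityMeasure μ]
    {G : Ω → SimpleGraph (Fin n)} (hG : IsRandomGraph P μ G) {η : ℝ} (hη : 0 < η)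
    (hη' : η ≤ 1 / 2) (hn : 10 ≤ n) (hlog : 1 ≤ Real.log n)
    (hP : ∀ i j, i ≠ j → 108 / η * Real.sqrt (Real.log n / n) ≤ P i j ∧ P i j ≤ 1)
    {T : HCTree n} (hT : IsOptimalTree P T) :
    1 - (n : ℝ) ^ (-(1 / 2) : ℝ) <
      μ.real {ω | (((1 - 4 * η) * (totalCost P T / expBaseCost μ G) : ℝ) : EReal) ≤
          optRatioCost (unitWeight (G ω)) ∧
        optRatioCost (unitWeight (G ω)) ≤
          (((1 + 4 * η) * (totalCost P T / expBaseCost μ G) : ℝ) : EReal)} := by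
  have hn0 : (0 : ℝ) < n := by exact_mod_cast (by omega : 0 < n)
  set r := Real.sqrt (Real.log n / n) with hr
  have hr0 : 0 < r := Real.sqrt_pos.2 (div_pos (by linarith) hn0)
  have hr2 : r ^ 2 * n = Real.log n := by
    rw [hr, Real.sq_sqrt (div_pos (by linarith) hn0).le]
    field_simp
  have hq0 : 0 < 108 / η * r := by positivity
  have hN := card_triplets_ge (show 3 ≤ n by omega)
  have hbase : 0 < baseCost P :=
    baseCost_pos (by omega) fun i j hij => hq0.trans_le (hP i j hij).1
  -- The constant `108 = 216 / 2` makes `2 * (108 / η * r) * n ^ 3 / 216` equal to `n ^ 3 * r / η`.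
  have hTC : ∀ T' : HCTree n, n * (n ^ 2 * r) ≤ η * totalCost P T' := by
    intro T'
    have h1 := le_baseCost fun i j hij => (hP i j hij).1
    have h2 := baseCost_le_totalCost (fun i j hij => hq0.le.trans (hP i j hij).1) T'
    calc (n : ℝ) * (n ^ 2 * r) = η * (2 * (108 / η * r) * (n ^ 3 / 216)) := by
          field_simp
          norm_num
      _ ≤ η * (2 * (108 / η * r) * (triplets n).card) := by gcongr
      _ ≤ η * totalCost P T' := by
          gcongr
          exact h1.trans h2
  have hEBC : 54 * n ^ 2 * Real.log n ≤ η ^ 2 * expBaseCost μ G := by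
    have h1 := hG.le_expBaseCost hq0.le hP
    calc 54 * n ^ 2 * Real.log n = η ^ 2 * ((108 / η * r) ^ 2 * (n ^ 3 / 216)) := by
          rw [← hr2]
          field_simp
          norm_num
      _ ≤ η ^ 2 * ((108 / η * r) ^ 2 * (triplets n).card) := by gcongr
      _ ≤ _ := by gcongr
  have hEBC' : (54 : ℝ) * n ^ 2 ≤ η ^ 2 * expBaseCost μ G :=
    (le_mul_of_one_le_right (by positivity) hlog).trans hEBC
  have hEpos : 0 < expBaseCost μ G :=
    pos_of_mul_pos_right ((by positivity : (0 : ℝ) < 54 * n ^ 2).trans_le hEBC') (sq_nonneg η)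
  -- Chosen so that `2 * t ^ 2 / n ^ 2 = 2 * n * log n`, twice the exponent of `n ^ n = exp (n * log
  -- n)`.
  set t := (n : ℝ) ^ 2 * r with ht
  have ht0 : 0 < t := by positivity
  set S := {ω | (((1 - 4 * η) * (totalCost P T / expBaseCost μ G) : ℝ) : EReal) ≤
          optRatioCost (unitWeight (G ω)) ∧
        optRatioCost (unitWeight (G ω)) ≤
          (((1 + 4 * η) * (totalCost P T / expBaseCost μ G) : ℝ) : EReal)}
  set B₁ := {ω | ∃ f, t ≤ |cutWeight (unitWeight (G ω)) f - cutWeight P f|}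
  set B₂ := {ω | η * expBaseCost μ G ≤ |baseCost (unitWeight (G ω)) - expBaseCost μ G|}
  -- A cover of the whole space, instead of a complement, avoids measurability of `S`.
  have hcover : (Set.univ : Set Ω) ⊆ S ∪ (B₁ ∪ B₂) := by
    intro ω _
    by_contra hω
    simp only [Set.mem_union, not_or] at hω
    obtain ⟨h0, h1, h2⟩ := hω
    simp only [B₁, B₂, Set.mem_ofPred_eq, not_exists, not_le] at h1 h2
    refine h0 (optRatioCost_mem_Icc hη hη' hEpos h2.le (fun T' => ?_)
      (hT.totalCost_le hbase) (hbase.le.trans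
        (baseCost_le_totalCost (fun i j hij => hq0.le.trans (hP i j hij).1) T)))
    exact (abs_totalCost_sub_le ht0.le (fun f => (h1 f).le) T').trans (hTC T')
  have hB₁ : μ.real B₁ ≤ 2 / n := by
    refine (hG.measureReal_exists_cutWeight_le ht0).trans ?_
    have h1 : -2 * t ^ 2 / (n : ℝ) ^ 2 = -(2 * (n * Real.log n)) := by
      rw [ht, ← hr2]
      field_simp
    have h2 : (n : ℝ) ^ n = Real.exp (n * Real.log n) := by
      rw [mul_comm, Real.exp_mul, Real.exp_log hn0, Real.rpow_natCast]
    rw [h1, h2]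
    calc Real.exp (n * Real.log n) * (2 * Real.exp (-(2 * (n * Real.log n))))
        = 2 * Real.exp (-(n * Real.log n)) := by
          rw [mul_left_comm, ← Real.exp_add]
          ring_nf
      _ ≤ 2 * Real.exp (-Real.log n) := by
          gcongr
          exact le_mul_of_one_le_left (by linarith) (by exact_mod_cast (by omega : 1 ≤ n))
      _ = 2 / n := by rw [Real.exp_neg, Real.exp_log hn0, div_eq_mul_inv]
  have hB₂ : μ.real B₂ ≤ 1 / n := by
    refine (hG.measureReal_baseCost_le hη hEpos).trans ?_
    calc 18 * (n : ℝ) / (η ^ 2 * expBaseCost μ G) ≤ 18 * n / (54 * n ^ 2) := by gcongr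
      _ = 1 / 3 / (n : ℝ) := by field_simp; norm_num
      _ ≤ 1 / (n : ℝ) := by gcongr; norm_num
  have hsum : 1 ≤ μ.real S + 3 / n := by
    calc (1 : ℝ) = μ.real Set.univ := probReal_univ.symm
      _ ≤ μ.real (S ∪ (B₁ ∪ B₂)) := measureReal_mono hcover
      _ ≤ μ.real S + (μ.real B₁ + μ.real B₂) := (measureReal_union_le _ _).trans
          (by gcongr; exact measureReal_union_le _ _)
      _ ≤ μ.real S + (2 / n + 1 / n) := by gcongr
      _ = _ := by ring
  -- Equivalent to `3 < √n`, which is why `10 ≤ n` is required.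
  have hpow : 3 / (n : ℝ) < (n : ℝ) ^ (-(1 / 2) : ℝ) := by
    rw [Real.rpow_neg hn0.le, ← Real.sqrt_eq_rpow]
    have h3 : 3 < Real.sqrt n := by
      rw [Real.lt_sqrt (by norm_num)]
      exact_mod_cast (by omega : 3 ^ 2 < n)
    have hs : 0 < Real.sqrt n := by linarith
    rw [div_lt_iff₀ hn0]
    calc (3 : ℝ) < Real.sqrt n := h3
      _ = (Real.sqrt n)⁻¹ * n := by
        nth_rewrite 3 [← Real.mul_self_sqrt hn0.le]
        field_simp
  linarith

theorem mainTheorem4 :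
    -- concentration of the optimal ratio cost, with high probability
    (∃ ε : ℝ, 0 < ε ∧
      ∀ P : (n : ℕ) → Matrix (Fin n) (Fin n) ℝ,
        (∀ n, IsEdgeProbMatrix (P n)) →
        (∀ C : ℝ, 0 < C → ∀ᶠ n : ℕ in atTop, ∀ i j : Fin n, i ≠ j →
          C * Real.sqrt (Real.log n / n) ≤ P n i j) →
        ∃ δ : ℕ → ℝ, Tendsto δ atTop (nhds 0) ∧
          ∀ᶠ n : ℕ in atTop,
            ∀ (Ω : Type*) [MeasurableSpace Ω] (μ : Measure Ω) [IsProbabilityMeasure μ]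
              (G : Ω → SimpleGraph (Fin n)), IsRandomGraph (P n) μ G →
            ∀ T : HCTree n, IsOptimalTree (P n) T →
              1 - (n : ℝ) ^ (-ε) <
                μ.real {ω |
                  (((1 - δ n) * (totalCost (P n) T / expBaseCost μ G) : ℝ) : EReal) ≤
                      optRatioCost (unitWeight (G ω)) ∧
                    optRatioCost (unitWeight (G ω)) ≤
                      (((1 + δ n) * (totalCost (P n) T / expBaseCost μ G) : ℝ) : EReal)}) ∧
    -- the value differs from the optimal ratio cost of the expectation graph
    (∀ (n : ℕ), 3 ≤ n → ∀ P : Matrix (Fin n) (Fin n) ℝ, IsEdgeProbMatrix P →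
      (∀ i j, i ≠ j → 0 < P i j ∧ P i j < 1) →
      ∀ (Ω : Type*) [MeasurableSpace Ω] (μ : Measure Ω) [IsProbabilityMeasure μ]
        (G : Ω → SimpleGraph (Fin n)), IsRandomGraph P μ G →
      ∀ T : HCTree n, IsOptimalTree P T →
        optRatioCost P ≠ ((totalCost P T / expBaseCost μ G : ℝ) : EReal)) ∧
    -- for constant edge probability `p` it stays at a fixed distance from it
    (∀ p : ℝ, 0 < p → p < 1 → ∀ n : ℕ, 3 ≤ n →
      ∀ (Ω : Type*) [MeasurableSpace Ω] (μ : Measure Ω) [IsProbabilityMeasure μ]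
        (G : Ω → SimpleGraph (Fin n)), IsRandomGraph (Matrix.of fun _ _ => p) μ G →
      ∀ T : HCTree n, IsOptimalTree (Matrix.of fun _ _ => p) T →
        optRatioCost (Matrix.of fun _ _ : Fin n => p) = 1 ∧
        totalCost (Matrix.of fun _ _ => p) T / expBaseCost μ G = 2 / (3 * p - p ^ 2) ∧
        1 < 2 / (3 * p - p ^ 2)) := by
  refine ⟨⟨1 / 2, by norm_num, fun P hP hmin => ?_⟩, ?_, ?_⟩
  · refine exists_tendsto_zero_of_eventually (Q := fun n d =>
      ∀ (Ω : Type _) [MeasurableSpace Ω] (μ : Measure Ω) [IsProbabilityMeasure μ]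
        (G : Ω → SimpleGraph (Fin n)), IsRandomGraph (P n) μ G →
      ∀ T : HCTree n, IsOptimalTree (P n) T →
        1 - (n : ℝ) ^ (-(1 / 2) : ℝ) <
          μ.real {ω |
            (((1 - d) * (totalCost (P n) T / expBaseCost μ G) : ℝ) : EReal) ≤
                optRatioCost (unitWeight (G ω)) ∧
              optRatioCost (unitWeight (G ω)) ≤
                (((1 + d) * (totalCost (P n) T / expBaseCost μ G) : ℝ) : EReal)})
      fun m => ?_
    -- A quarter of the target error, since passing to ratios costs a factor 4.
    set η : ℝ := 1 / ((m : ℝ) + 1) / 4 with hη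
    have hη0 : 0 < η := by positivity
    have hη1 : η ≤ 1 / 2 := by
      have : 1 / ((m : ℝ) + 1) ≤ 1 := by
        rw [div_le_one (by positivity)]
        linarith [Nat.cast_nonneg (α := ℝ) m]
      rw [hη]
      linarith
    have hη4 : 1 / ((m : ℝ) + 1) = 4 * η := by rw [hη]; ring
    rw [hη4]
    filter_upwards [hmin (108 / η) (by positivity), eventually_ge_atTop 10,
      (Real.tendsto_log_atTop.comp tendsto_natCast_atTop_atTop).eventually_ge_atTop 1]
      with n hn hn10 hlog Ω _ μ _ G hG T hT
    exact hG.lt_measureReal_optRatioCost hη0 hη1 hn10 hlog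
      (fun i j hij => ⟨hn i j hij, ((hP n).mem_Icc i j).2⟩) hT
  · intro n hn P _ hP Ω _ μ _ G hG T hT
    have hbase := baseCost_pos hn fun i j hij => (hP i j hij).1
    rw [hT.optRatioCost_eq, ratioCost_of_ne_zero hbase.ne']
    refine ne_of_lt (EReal.coe_lt_coe_iff.2 ?_)
    exact div_lt_div_of_pos_left
      (hbase.trans_le (baseCost_le_totalCost (fun i j hij => (hP i j hij).1.le) T))
      (hG.expBaseCost_pos hn hP) (hG.expBaseCost_lt_baseCost hn hP)
  · intro p hp hp1 n hn Ω _ μ _ G hG T hT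
    have hcard : (0 : ℝ) < (triplets n).card := by exact_mod_cast (triplets_nonempty hn).card_pos
    have hden : 0 < 3 * p - p ^ 2 := by nlinarith
    refine ⟨?_, ?_, ?_⟩
    · rw [hT.optRatioCost_eq, ratioCost_of_ne_zero (by rw [baseCost_const]; positivity),
        hT.totalCost_const hn hp, baseCost_const, div_self (by positivity), EReal.coe_one]
    · rw [hT.totalCost_const hn hp, hG.expBaseCost_const,
        mul_div_mul_right _ _ hcard.ne', div_eq_div_iff (by nlinarith [mul_pos hp hden]) hden.ne']
      ring
    · rw [one_lt_div hden]
      -- The claim `3 * p - p ^ 2 < 2` is `0 < (1 - p) * (2 - p)`.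
      nlinarith [mul_pos (sub_pos.2 hp1) (by linarith : 0 < 2 - p)]
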